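/- Let $\mathfrak R$ be a $W^*$-algebra, i.e. a $C^*$-algebra that is $*$-isomorphic to a von Neumann algebra on some (not necessarily separable) complex Hilbert space. Order the projections of $\mathfrak R$ (the elements $e=e^*=e^2$) by $e\le f$ iff $ef=e=fe$. A projection is called atomic if it is minimal among the nonzero projections; $\mathfrak R$ is called atomic if for every nonzero projection $e\in\mathfrak R$ there is an atomic projection $f\le e$; and $\mathfrak R$ is called $\sigma$-finite if every set of pairwise orthogonal projections in $\mathfrak R$ is countable. Then the following conditions are equivalent. 1. $\mathfrak R$ is $\sigma$-finite and atomic. 2. $\mathfrak R$ is $*$-isomorphic to $\bigoplus_{i=1}^{n} B(\mathcal H_i)$ for some $n\in\mathbb N\cup\{\infty\}$ and separable complex Hilbert spaces $\mathcal H_i$, where $\bigoplus$ denotes the $\ell^\infty$-direct sum (norm-bounded families $(x_i)_i$ with $x_i\in B(\mathcal H_i)$, componentwise operations and supremum norm). Here $n=0$ (the zero algebra) and $\mathcal H_i=0$ are allowed. -/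

import Mathlib

universe u v w

open scoped ENNReal

/-- A C⋆-algebra is a W⋆-algebra if it is ⋆-isomorphic to a von Neumann algebra acting on some
(not necessarily separable) complex Hilbert space. -/
def IsWStarAlgebra (R : Type u) [CStarAlgebra R] : Prop :=
  ∃ (H : Type v) (_ : NormedAddCommGroup H) (_ : InnerProductSpace ℂ H) (_ : CompleteSpace H)
    (S : VonNeumannAlgebra H), Nonempty (R ≃⋆ₐ[ℂ] S.toStarSubalgebra)

/-- The order on projections: `e ≤ f` iff `e * f = e = f * e`. -/
def ProjectionLE {R : Type u} [CStarAlgebra R] (e f : R) : Prop :=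
  e * f = e ∧ f * e = e

/-- An atomic projection is a minimal element of the set of nonzero projections. -/
def IsAtomicProjection {R : Type u} [CStarAlgebra R] (e : R) : Prop :=
  IsStarProjection e ∧ e ≠ 0 ∧
    ∀ f : R, IsStarProjection f → f ≠ 0 → ProjectionLE f e → f = e

/-- The algebra is atomic: every nonzero projection has an atomic subprojection. -/
def IsAtomicAlgebra (R : Type u) [CStarAlgebra R] : Prop :=
  ∀ e : R, IsStarProjection e → e ≠ 0 → ∃ f : R, IsAtomicProjection f ∧ ProjectionLE f e

/-- The algebra is σ-finite (countably decomposable): every set of pairwise orthogonal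
projections is countable. -/
def IsSigmaFiniteAlgebra (R : Type u) [CStarAlgebra R] : Prop :=
  ∀ P : Set R, (∀ e ∈ P, IsStarProjection e) → (P.Pairwise fun e f => e * f = 0) → P.Countable

/-- `R` is ⋆-isomorphic to `⨁_{i < n} B(H i)` for some `n ∈ ℕ ∪ {∞}` and separable complex Hilbert
spaces `H i`. The direct sum of W⋆-algebras is the ℓ^∞-direct sum: norm-bounded families
`(x i)`, `x i ∈ B(H i)`, with componentwise operations and the supremum norm. -/
def IsCountableSumOfBoundedOperators (R : Type u) [CStarAlgebra R] : Prop :=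
  ∃ (n : ℕ∞) (H : {i : ℕ // (i : ℕ∞) < n} → Type w)
    (_ : ∀ i, NormedAddCommGroup (H i)) (_ : ∀ i, InnerProductSpace ℂ (H i))
    (_ : ∀ i, CompleteSpace (H i)),
    (∀ i, TopologicalSpace.SeparableSpace (H i)) ∧
      Nonempty (R ≃⋆ₐ[ℂ] lp (fun i => H i →L[ℂ] H i) ∞)

/-! Represent the algebra faithfully by `ρ` with range a von Neumann algebra. That range is closed
under weak limits and contains supports.

If `e` is an atom and `y` is self-adjoint with `y * e = y`, the support of the positive part of `y`
is `0` or `e`, so `y` has a definite sign. Applied to `d - t • e` for real `t`, this gives `eRe =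
ℂe` (`IsAtomicProjection.exists_eq_smul`). For a unit vector `k` fixed by `ρ e`, it follows that `‖x
* e‖ = ‖ρ x k‖`, so the invariant subspace `ρ(R)k` is isometric to `Re` and closed. An orthonormal
basis of it lifts to orthogonal projections in `R`, so σ-finiteness makes it separable.

Zorn gives a maximal family of atoms `e i` with `e i * R * e j = 0`, countable by σ-finiteness. The
restrictions of `ρ` to the spaces `ρ(R)(k i)` form a map into the ℓ^∞-sum. Atomicity and maximality
make it injective; weak limits of sums of elements `x * e i * star y` make it surjective.

Conversely, separable summands bound orthogonal families, and rank-one projections in one coordinate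
are atoms. -/

/-! ### Weak limits and supports in von Neumann algebras -/

section VonNeumann

open Filter Topology InnerProductSpace

variable {H : Type v} [NormedAddCommGroup H] [InnerProductSpace ℂ H] [CompleteSpace H]

/-- Bounded nets of operators have cluster points in the weak operator topology. -/
theorem exists_weak_limit_of_bounded {ι : Type*} (u : Ultrafilter ι) (a : ι → H →L[ℂ] H) (C : ℝ)
    (ha : ∀ i, ‖a i‖ ≤ C) :
    ∃ A : H →L[ℂ] H, ∀ x y, Tendsto (fun i => ⟪a i x, y⟫_ℂ) u (𝓝 ⟪A x, y⟫_ℂ) := by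
  have hbd : ∀ x y i, ‖⟪a i x, y⟫_ℂ‖ ≤ C * ‖x‖ * ‖y‖ := fun x y i =>
    (norm_inner_le_norm _ _).trans (by
      gcongr
      exact (a i).le_of_opNorm_le (ha i) x)
  have hlim : ∀ x y, ∃ c, ‖c‖ ≤ C * ‖x‖ * ‖y‖ ∧ Tendsto (fun i => ⟪a i x, y⟫_ℂ) u (𝓝 c) := by
    intro x y
    obtain ⟨c, hc, h⟩ := (isCompact_closedBall (0 : ℂ) (C * ‖x‖ * ‖y‖)).ultrafilter_le_nhds
      (u.map fun i => ⟪a i x, y⟫_ℂ) (by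
        rw [Ultrafilter.coe_map, le_principal_iff]
        exact mem_map.2 (Eventually.of_forall fun i => by simpa using hbd x y i))
    exact ⟨c, by simpa using hc, h⟩
  choose L hL ht using hlim
  let B : H →L⋆[ℂ] H →L[ℂ] ℂ := LinearMap.mkContinuous₂
    (LinearMap.mk₂'ₛₗ (starRingEnd ℂ) (RingHom.id ℂ) L
      (fun x x' y => tendsto_nhds_unique (ht _ _) (by
        simpa [inner_add_left] using (ht x y).add (ht x' y)))
      (fun c x y => tendsto_nhds_unique (ht _ _) (by
        simpa [inner_smul_left, mul_comm] using (ht x y).const_mul (starRingEnd ℂ c)))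
      (fun x y y' => tendsto_nhds_unique (ht _ _) (by
        simpa [inner_add_right] using (ht x y).add (ht x y')))
      (fun c x y => tendsto_nhds_unique (ht _ _) (by
        simpa [inner_smul_right] using (ht x y).const_mul c))) C (fun x y => hL x y)
  refine ⟨continuousLinearMapOfBilin B, fun x y => ?_⟩
  rw [continuousLinearMapOfBilin_apply]
  exact ht x y

/-- A von Neumann algebra is closed under weak limits. -/
theorem VonNeumannAlgebra.mem_of_weak_limit (S : VonNeumannAlgebra H) {ι : Type*} {l : Filter ι}
    [l.NeBot] {a : ι → H →L[ℂ] H} (ha : ∀ i, a i ∈ S) {A : H →L[ℂ] H}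
    (hA : ∀ x y, Tendsto (fun i => ⟪a i x, y⟫_ℂ) l (𝓝 ⟪A x, y⟫_ℂ)) : A ∈ S := by
  rw [← S.commutant_commutant, mem_commutant_iff]
  intro y hy
  refine ContinuousLinearMap.ext fun x => ext_inner_right ℂ fun z => ?_
  refine tendsto_nhds_unique (f := fun i => ⟪a i (y x), z⟫_ℂ) ?_ (hA _ _)
  have h : ∀ i, ⟪a i (y x), z⟫_ℂ = ⟪a i x, ContinuousLinearMap.adjoint y z⟫_ℂ := fun i => by
    rw [ContinuousLinearMap.adjoint_inner_right]
    exact congrArg (⟪· x, z⟫_ℂ) (mem_commutant_iff.1 hy (a i) (ha i))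
  simp_rw [h]
  rw [mul_apply_eq_comp, ← ContinuousLinearMap.adjoint_inner_right]
  exact hA _ _

/-- The projection onto the orthogonal complement of the kernel of an element of a von Neumann
algebra belongs to the algebra. -/
theorem VonNeumannAlgebra.starProjection_ker_orthogonal_mem (S : VonNeumannAlgebra H)
    {a : H →L[ℂ] H} (ha : a ∈ S) : (a.ker)ᗮ.starProjection ∈ S := by
  rw [VonNeumannAlgebra.IsStarProjection.mem_iff isStarProjection_starProjection]
  intro y hy
  rw [Submodule.range_starProjection, Module.End.mem_invtSubmodule]
  intro x hx
  rw [Submodule.mem_comap, Submodule.mem_orthogonal]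
  intro n hn
  -- The adjoint of `y` also commutes with `a`, hence preserves its kernel; so `y` preserves the
  -- orthogonal complement.
  have h := mem_commutant_iff.1 (star_mem hy) a ha
  change ⟪n, y x⟫_ℂ = 0
  rw [← ContinuousLinearMap.adjoint_inner_left]
  refine hx _ ?_
  have h2 := congrArg (· n) h
  simp only [mul_apply_eq_comp, ContinuousLinearMap.star_eq_adjoint] at h2
  have hn' : a n = 0 := hn
  simpa [hn'] using h2

variable {R : Type u} [CStarAlgebra R]

/-- Right support projections exist in `W⋆`-algebras. -/
theorem exists_right_support (ρ : R →⋆ₐ[ℂ] (H →L[ℂ] H)) (hρ : Function.Injective ρ)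
    (S : VonNeumannAlgebra H) (hS : Set.range ρ = S) (a : R) :
    ∃ p : R, IsStarProjection p ∧ a * p = a ∧ ∀ b, a * b = 0 → p * b = 0 := by
  have haS : ρ a ∈ S := by rw [← SetLike.mem_coe, ← hS]; exact ⟨a, rfl⟩
  have hpS := S.starProjection_ker_orthogonal_mem haS
  rw [← SetLike.mem_coe, ← hS] at hpS
  obtain ⟨p, hp⟩ := hpS
  refine ⟨p, ?_, hρ ?_, fun b hb => hρ ?_⟩
  · have h := isStarProjection_starProjection (U := (ρ a).kerᗮ)
    rw [← hp, isStarProjection_iff'] at h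
    rw [isStarProjection_iff']
    exact ⟨hρ (by rw [map_mul, h.1]), hρ (by rw [map_star, h.2])⟩
  · rw [map_mul, hp]
    ext x
    have h : (ρ a).ker.starProjection x ∈ (ρ a).ker := Submodule.starProjection_apply_mem _ _
    have h' : ρ a ((ρ a).ker.starProjection x) = 0 := h
    simp [Submodule.starProjection_orthogonal, h']
  · rw [map_mul, hp, map_zero]
    ext x
    rw [mul_apply_eq_comp, zero_apply,
      Submodule.starProjection_apply_eq_zero_iff, Submodule.orthogonal_orthogonal_eq_closure]
    refine Submodule.le_topologicalClosure _ ?_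
    change ρ a (ρ b x) = 0
    rw [← mul_apply_eq_comp, ← map_mul, hb, map_zero]
    rfl

end VonNeumann

/-! ### Corners of atomic projections -/

section Atoms

open Filter Topology InnerProductSpace

variable {R : Type u} [CStarAlgebra R] {H : Type v} [NormedAddCommGroup H] [InnerProductSpace ℂ H]
  [CompleteSpace H]

theorem inner_map_star_mul_self (ρ : R →⋆ₐ[ℂ] (H →L[ℂ] H)) (x y : R) (h k : H) :
    ⟪ρ (star x * y) h, k⟫_ℂ = ⟪ρ y h, ρ x k⟫_ℂ := by
  rw [map_mul, map_star, mul_apply_eq_comp,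
    ContinuousLinearMap.star_eq_adjoint, ContinuousLinearMap.adjoint_inner_left]

theorem inner_map_apply (ρ : R →⋆ₐ[ℂ] (H →L[ℂ] H)) (x : R) (h k : H) :
    ⟪ρ x h, k⟫_ℂ = ⟪h, ρ (star x) k⟫_ℂ := by
  rw [map_star, ContinuousLinearMap.star_eq_adjoint, ContinuousLinearMap.adjoint_inner_right]

/-- A self-adjoint element supported on an atomic projection has a definite sign. -/
theorem IsAtomicProjection.definite (ρ : R →⋆ₐ[ℂ] (H →L[ℂ] H)) (hρ : Function.Injective ρ)
    (S : VonNeumannAlgebra H) (hS : Set.range ρ = S) {e : R} (he : IsAtomicProjection e) {y : R}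
    (hy : IsSelfAdjoint y) (hye : y * e = y) :
    (∀ h, 0 ≤ (⟪ρ y h, h⟫_ℂ).re) ∨ ∀ h, (⟪ρ y h, h⟫_ℂ).re ≤ 0 := by
  let _ := CStarAlgebra.spectralOrder R
  let _ := CStarAlgebra.spectralOrderedRing R
  have hpos : ∀ z : R, 0 ≤ z → ∀ h, 0 ≤ (⟪ρ z h, h⟫_ℂ).re := by
    intro z hz h
    obtain ⟨x, rfl⟩ := CStarAlgebra.nonneg_iff_eq_star_mul_self.1 hz
    rw [inner_map_star_mul_self]
    exact inner_self_nonneg (𝕜 := ℂ)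
  have hp0 := CFC.posPart_nonneg y
  have hn0 := CFC.negPart_nonneg y
  have hpn := CFC.posPart_mul_negPart y
  have hnp := CFC.negPart_mul_posPart y
  have hsub := CFC.posPart_sub_negPart y hy
  generalize y⁺ = p at *
  generalize y⁻ = n at *
  have hps : star p = p := (IsSelfAdjoint.of_nonneg hp0).star_eq
  have hns : star n = n := (IsSelfAdjoint.of_nonneg hn0).star_eq
  have hes := he.1.isSelfAdjoint.star_eq
  -- C⋆-identity for `z * (1 - e)`. It applies to both parts of `y` because `p * p = p * y` and `n *
  -- n = -(n * y)`.
  have key : ∀ z : R, star z = z → z * z * (1 - e) = 0 → z * e = z := by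
    intro z hz h
    have : z * (1 - e) = 0 := by
      rw [← CStarRing.star_mul_self_eq_zero_iff, star_mul, hz, mul_assoc, ← mul_assoc z, h,
        mul_zero]
    rw [mul_sub, mul_one, sub_eq_zero] at this
    exact this.symm
  have hpe : p * e = p := by
    refine key p hps ?_
    have : p * p = p * y := by rw [← hsub, mul_sub, hpn, sub_zero]
    rw [this, mul_assoc, mul_sub, hye, mul_one, sub_self, mul_zero]
  have hne : n * e = n := by
    refine key n hns ?_
    have : n * n = -(n * y) := by rw [← hsub, mul_sub, hnp, zero_sub, neg_neg]
    rw [this, neg_mul, mul_assoc, mul_sub, hye, mul_one, sub_self, mul_zero, neg_zero]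
  by_cases hp : p = 0
  · right
    intro h
    have := hpos n hn0 h
    rw [← hsub, hp, zero_sub, map_neg]
    simpa using this
  · left
    -- The support of `p` is a nonzero subprojection of `e`, hence equals `e`; then `p * n = 0`
    -- forces `e * n = 0`.
    obtain ⟨q, hq, hpq, hqb⟩ := exists_right_support ρ hρ S hS p
    have hqe : q * e = q := by
      have := hqb (1 - e) (by rw [mul_sub, hpe, mul_one, sub_self])
      rwa [mul_sub, mul_one, sub_eq_zero, eq_comm] at this
    have hqs := hq.isSelfAdjoint.star_eq
    have heq : e * q = q := by simpa [hqs, hes] using congrArg star hqe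
    have hq0 : q ≠ 0 := fun h => hp (by rw [← hpq, h, mul_zero])
    have hqe' := he.2.2 q hq hq0 ⟨hqe, heq⟩
    have h0 : e * n = 0 := hqe' ▸ hqb n hpn
    have hn : n = 0 := by
      rw [← hne, ← hns, ← hes, ← star_mul, h0, star_zero]
    intro h
    rw [← hsub, hn, sub_zero]
    exact hpos p hp0 h

/-- The corner of an atomic projection is one-dimensional. -/
theorem IsAtomicProjection.exists_eq_smul (ρ : R →⋆ₐ[ℂ] (H →L[ℂ] H)) (hρ : Function.Injective ρ)
    (S : VonNeumannAlgebra H) (hS : Set.range ρ = S) {e : R} (he : IsAtomicProjection e) (a : R) :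
    ∃ c : ℂ, e * a * e = c • e := by
  have hes := he.1.isSelfAdjoint.star_eq
  have hee : e * e = e := he.1.isIdempotentElem
  obtain ⟨k, hk⟩ : ∃ k, ρ e k ≠ 0 := by
    by_contra! h
    exact he.2.1 (hρ (by rw [map_zero]; ext k; simp [h k]))
  have hsq : ∀ h, (⟪ρ e h, h⟫_ℂ) = (‖ρ e h‖ ^ 2 : ℝ) := fun h => by
    have := inner_map_star_mul_self ρ e e h h
    rw [hes, hee] at this
    rw [this, inner_self_eq_norm_sq_to_K]
    simp
  have hsa : ∀ b : R, IsSelfAdjoint b → ∃ c : ℂ, e * b * e = c • e := by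
    intro b hb
    set d := e * b * e with hd
    have hds : star d = d := by simp [hd, hes, hb.star_eq, mul_assoc]
    have hde : d * e = d := by rw [hd, mul_assoc, hee]
    have hyt : ∀ t : ℝ, IsSelfAdjoint (d - (t : ℂ) • e) := fun t => by
      rw [isSelfAdjoint_iff]; simp [hds, hes]
    have hform : ∀ (t : ℝ) h, (⟪ρ (d - (t : ℂ) • e) h, h⟫_ℂ).re =
        (⟪ρ d h, h⟫_ℂ).re - t * ‖ρ e h‖ ^ 2 := fun t h => by
      rw [map_sub, map_smul, sub_apply, inner_sub_left, smul_apply, inner_smul_left, hsq]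
      simp [-Complex.ofReal_pow]
    have hdef := fun t : ℝ => he.definite ρ hρ S hS (hyt t) (by
      rw [sub_mul, hde, smul_mul_assoc, hee])
    simp only [hform] at hdef
    have hk2 : 0 < ‖ρ e k‖ ^ 2 := by positivity
    -- The value at `k` decides the sign of `d - t • e` on either side of `c`; letting `t` tend to
    -- `c` from both sides makes the form of `d - c • e` vanish.
    set c : ℝ := (⟪ρ d k, k⟫_ℂ).re / ‖ρ e k‖ ^ 2 with hc
    have hck : (⟪ρ d k, k⟫_ℂ).re = c * ‖ρ e k‖ ^ 2 := by rw [hc, div_mul_cancel₀ _ hk2.ne']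
    have hlow : ∀ t < c, ∀ h, 0 ≤ (⟪ρ d h, h⟫_ℂ).re - t * ‖ρ e h‖ ^ 2 := fun t ht =>
      (hdef t).resolve_right fun h => by nlinarith [h k]
    have hupp : ∀ t, c < t → ∀ h, (⟪ρ d h, h⟫_ℂ).re - t * ‖ρ e h‖ ^ 2 ≤ 0 := fun t ht =>
      (hdef t).resolve_left fun h => by nlinarith [h k]
    have hcont : ∀ h, ContinuousAt (fun t : ℝ => (⟪ρ d h, h⟫_ℂ).re - t * ‖ρ e h‖ ^ 2) c :=
      fun h => by fun_prop
    have hzero : ∀ h, (⟪ρ d h, h⟫_ℂ).re - c * ‖ρ e h‖ ^ 2 = 0 := fun h => by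
      refine le_antisymm ?_ ?_
      · exact le_of_tendsto ((hcont h).tendsto.mono_left nhdsWithin_le_nhds)
          (eventually_nhdsWithin_of_forall (s := Set.Ioi c) fun t ht => hupp t ht h)
      · exact ge_of_tendsto ((hcont h).tendsto.mono_left nhdsWithin_le_nhds)
          (eventually_nhdsWithin_of_forall (s := Set.Iio c) fun t ht => hlow t ht h)
    refine ⟨c, sub_eq_zero.1 (hρ ?_)⟩
    rw [map_zero]
    refine (ContinuousLinearMap.coe_inj).1 ((inner_map_self_eq_zero _).1 fun h => ?_)
    change ⟪ρ (d - (c : ℂ) • e) h, h⟫_ℂ = 0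
    refine Complex.ext ((hform c h).trans (hzero h)) ?_
    have h1 := inner_map_apply ρ (d - (c : ℂ) • e) h h
    rw [(hyt c).star_eq, ← inner_conj_symm h] at h1
    have h2 := congrArg Complex.im h1
    simp only [Complex.conj_im] at h2
    simp only [Complex.zero_im]
    linarith
  obtain ⟨c, hc⟩ := hsa _ (realPart a).2
  obtain ⟨d, hd⟩ := hsa _ (imaginaryPart a).2
  refine ⟨c + Complex.I * d, ?_⟩
  conv_lhs => rw [← realPart_add_I_smul_imaginaryPart a]
  rw [mul_add, add_mul, hc, mul_smul_comm, smul_mul_assoc, hd, add_smul, mul_smul]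

end Atoms

/-! ### Cyclic subspaces generated by atoms -/

section Cyclic

open Filter Topology InnerProductSpace

variable {R : Type u} [CStarAlgebra R] {H : Type v} [NormedAddCommGroup H] [InnerProductSpace ℂ H]
  [CompleteSpace H]

/-- The corner of an atomic projection is given by the vector state of any unit vector in its
range. -/
theorem IsAtomicProjection.corner_eq (ρ : R →⋆ₐ[ℂ] (H →L[ℂ] H)) (hρ : Function.Injective ρ)
    (S : VonNeumannAlgebra H) (hS : Set.range ρ = S) {e : R} (he : IsAtomicProjection e)
    {k : H} (hk : ‖k‖ = 1) (hek : ρ e k = k) (x : R) :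
    e * x * e = ⟪k, ρ x k⟫_ℂ • e := by
  obtain ⟨c, hc⟩ := he.exists_eq_smul ρ hρ S hS x
  have h := congrArg (fun y => ⟪k, ρ y k⟫_ℂ) hc
  have hes := he.1.isSelfAdjoint.star_eq
  simp only [map_mul, mul_apply_eq_comp, map_smul, smul_apply, hek, inner_smul_right] at h
  have h2 := inner_map_apply ρ e k (ρ x k)
  rw [hes, hek] at h2
  rw [← h2, inner_self_eq_norm_sq_to_K, hk] at h
  rw [hc, h]
  simp

theorem IsAtomicProjection.norm_eq_one {e : R} (he : IsAtomicProjection e) : ‖e‖ = 1 := by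
  have h := CStarRing.norm_self_mul_star (x := e)
  rw [he.1.isSelfAdjoint.star_eq, he.1.isIdempotentElem.eq] at h
  have : ‖e‖ ≠ 0 := norm_ne_zero_iff.2 he.2.1
  exact mul_left_cancel₀ this (by rw [← h, mul_one])

/-- The corner formula turns `star (x * e) * (x * e)` into `‖ρ x k‖ ^ 2` times `e`. This identifies
the left ideal `Re` with `ρ(R)k`. -/
theorem IsAtomicProjection.norm_mul_eq (ρ : R →⋆ₐ[ℂ] (H →L[ℂ] H)) (hρ : Function.Injective ρ)
    (S : VonNeumannAlgebra H) (hS : Set.range ρ = S) {e : R} (he : IsAtomicProjection e)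
    {k : H} (hk : ‖k‖ = 1) (hek : ρ e k = k) (x : R) : ‖x * e‖ = ‖ρ x k‖ := by
  have hes := he.1.isSelfAdjoint.star_eq
  have h := CStarRing.norm_star_mul_self (x := x * e)
  rw [star_mul, hes, mul_assoc, ← mul_assoc (star x), ← mul_assoc,
    he.corner_eq ρ hρ S hS hk hek, ← inner_conj_symm, inner_map_star_mul_self,
    inner_self_eq_norm_sq_to_K, norm_smul, he.norm_eq_one, mul_one] at h
  have h' : ‖ρ x k‖ * ‖ρ x k‖ = ‖x * e‖ * ‖x * e‖ := by
    rw [← h]; simp [sq]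
  exact ((mul_self_inj (norm_nonneg _) (norm_nonneg _)).1 h').symm

/-- The cyclic subspace generated by a vector. -/
def cyclicSubspace (ρ : R →⋆ₐ[ℂ] (H →L[ℂ] H)) (k : H) : Submodule ℂ H where
  carrier := Set.range fun x : R => ρ x k
  add_mem' := by
    rintro _ _ ⟨x, rfl⟩ ⟨y, rfl⟩
    exact ⟨x + y, by simp⟩
  zero_mem' := ⟨0, by simp⟩
  smul_mem' := by
    rintro c _ ⟨x, rfl⟩
    exact ⟨c • x, by simp⟩

theorem mem_cyclicSubspace {ρ : R →⋆ₐ[ℂ] (H →L[ℂ] H)} {k h : H} :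
    h ∈ cyclicSubspace ρ k ↔ ∃ x : R, ρ x k = h := Iff.rfl

/-- A unit vector in the range of an atomic projection generates a closed cyclic subspace. -/
theorem IsAtomicProjection.isClosed_cyclicSubspace (ρ : R →⋆ₐ[ℂ] (H →L[ℂ] H))
    (hρ : Function.Injective ρ) (S : VonNeumannAlgebra H) (hS : Set.range ρ = S) {e : R}
    (he : IsAtomicProjection e) {k : H} (hk : ‖k‖ = 1) (hek : ρ e k = k) :
    IsClosed (cyclicSubspace ρ k : Set H) := by
  -- The left ideal `Re` is complete, and `x ↦ ρ x k` maps it isometrically onto the cyclic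
  -- subspace.
  let E : Set R := {x | x * e = x}
  have hE : IsClosed E := isClosed_eq (by fun_prop) continuous_id
  have : CompleteSpace E := hE.completeSpace_coe
  let f : E → H := fun x => ρ x k
  have hf : Isometry f := Isometry.of_dist_eq fun x y => by
    have h := he.norm_mul_eq ρ hρ S hS hk hek (x - y : R)
    rw [sub_mul, show (x : R) * e = x from x.2, show (y : R) * e = y from y.2] at h
    rw [Subtype.dist_eq, dist_eq_norm, dist_eq_norm, h]
    simp [f]
  convert hf.isClosedEmbedding.isClosed_range
  ext h
  constructor
  · rintro ⟨x, rfl⟩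
    exact ⟨⟨x * e, by simp [E, mul_assoc, he.1.isIdempotentElem.eq]⟩, by simp [f, hek]⟩
  · rintro ⟨x, rfl⟩
    exact ⟨x, rfl⟩

/-- The cyclic subspace of a vector in the range of an atomic projection of a σ-finite algebra is
separable; it is modelled on a sequence space. -/
theorem IsAtomicProjection.exists_cyclic_model (hσ : IsSigmaFiniteAlgebra R)
    (ρ : R →⋆ₐ[ℂ] (H →L[ℂ] H)) (hρ : Function.Injective ρ) (S : VonNeumannAlgebra H)
    (hS : Set.range ρ = S) {e : R} (he : IsAtomicProjection e) :
    ∃ (ι : Type w) (_ : Countable ι) (U : lp (fun _ : ι => ℂ) 2 →ₗᵢ[ℂ] H) (k : H),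
      ‖k‖ = 1 ∧ ρ e k = k ∧ Set.range U = cyclicSubspace ρ k := by
  have hes := he.1.isSelfAdjoint.star_eq
  have hee : e * e = e := he.1.isIdempotentElem
  obtain ⟨k₀, hk₀⟩ : ∃ k, ρ e k ≠ 0 := by
    by_contra! h
    exact he.2.1 (hρ (by rw [map_zero]; ext k; simp [h k]))
  set k : H := ((‖ρ e k₀‖⁻¹ : ℝ) : ℂ) • ρ e k₀ with hkdef
  have hk : ‖k‖ = 1 := by
    rw [hkdef, norm_smul]
    simp [inv_mul_cancel₀ (norm_ne_zero_iff.2 hk₀)]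
  have hek : ρ e k = k := by
    rw [hkdef, map_smul, ← mul_apply_eq_comp, ← map_mul, hee]
  have hcl := he.isClosed_cyclicSubspace ρ hρ S hS hk hek
  have : CompleteSpace (cyclicSubspace ρ k) := hcl.completeSpace_coe
  obtain ⟨s, b, -⟩ := exists_hilbertBasis ℂ (cyclicSubspace ρ k)
  choose x hx using fun α => mem_cyclicSubspace.1 (b α).2
  have hxx : ∀ α β, e * (star (x α) * x β) * e = ⟪b α, b β⟫_ℂ • e := fun α β => by
    rw [he.corner_eq ρ hρ S hS hk hek, ← inner_conj_symm, inner_map_star_mul_self,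
      inner_conj_symm, hx, hx]
    rfl
  -- By `hxx` the elements `x α * e` are partial isometries with initial projection `e` and mutually
  -- orthogonal range projections `p α`.
  let p : s → R := fun α => x α * e * star (x α)
  have hpp : ∀ α β, p α * p β = ⟪b α, b β⟫_ℂ • (x α * e * star (x β)) := fun α β => by
    have : p α * p β = x α * (e * (star (x α) * x β) * e) * star (x β) := by
      simp only [p, mul_assoc]
    rw [this, hxx]
    simp
  have hpn : ∀ α, p α * p α = p α := fun α => by
    rw [hpp, inner_self_eq_norm_sq_to_K, b.orthonormal.1]
    simp [p]
  have hpe : ∀ α, e * (star (x α) * p α * x α) * e = e := fun α => by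
    have : e * (star (x α) * p α * x α) * e =
        (e * (star (x α) * x α) * e) * (e * (star (x α) * x α) * e) := by
      simp only [p, mul_assoc]
      rw [← mul_assoc e e, hee]
    rw [this, hxx, inner_self_eq_norm_sq_to_K, b.orthonormal.1]
    simp [hee]
  have hp0 : ∀ α, p α ≠ 0 := fun α h => he.2.1 (by rw [← hpe α, h]; simp)
  have hpo : ∀ α β, α ≠ β → p α * p β = 0 := fun α β h => by
    rw [hpp, b.orthonormal.2 h, zero_smul]
  have hinj : Function.Injective p := fun α β h => by
    by_contra hne
    exact hp0 α (by rw [← hpn α]; nth_rewrite 2 [h]; exact hpo _ _ hne)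
  have hcount := hσ (Set.range p) (by
      rintro _ ⟨α, rfl⟩
      exact isStarProjection_iff'.2 ⟨hpn α, by simp [p, hes, mul_assoc]⟩) (by
      rintro _ ⟨α, rfl⟩ _ ⟨β, rfl⟩ hne
      exact hpo _ _ fun h => hne (h ▸ rfl))
  have : Countable (Set.range p) := hcount
  have : Countable s := (Set.rangeFactorization_injective.2 hinj).countable
  -- A countable index set can be moved to any universe, so the model space can live in universe
  -- `w`.
  let b' : HilbertBasis (Shrink.{w} s) ℂ (cyclicSubspace ρ k) :=
    HilbertBasis.mk (v := b ∘ (equivShrink.{w} s).symm)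
      (b.orthonormal.comp _ (equivShrink.{w} s).symm.injective) (by
        rw [(equivShrink.{w} s).symm.surjective.range_comp, b.dense_span])
  refine ⟨Shrink.{w} s, (equivShrink.{w} s).symm.injective.countable,
    (cyclicSubspace ρ k).subtypeₗᵢ.comp b'.repr.symm.toLinearIsometry, k, hk, hek, ?_⟩
  rw [LinearIsometry.coe_comp, Set.range_comp,
    show ⇑b'.repr.symm.toLinearIsometry = b'.repr.symm from rfl, b'.repr.symm.surjective.range_eq,
    Set.image_univ]
  simp

end Cyclic

/-! ### Restriction of a representation to a cyclic subspace -/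

section Compression

open Filter Topology InnerProductSpace

variable {R : Type u} [CStarAlgebra R] {H : Type v} [NormedAddCommGroup H] [InnerProductSpace ℂ H]
  [CompleteSpace H] {G : Type w} [NormedAddCommGroup G] [InnerProductSpace ℂ G] [CompleteSpace G]

theorem LinearIsometry.adjoint_apply_apply (U : G →ₗᵢ[ℂ] H) (g : G) :
    ContinuousLinearMap.adjoint U.toContinuousLinearMap (U g) = g :=
  ext_inner_left ℂ fun x => by
    rw [ContinuousLinearMap.adjoint_inner_right]
    exact U.inner_map_map x g

/-- The restriction of a representation to an invariant subspace. -/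
noncomputable def compression (ρ : R →⋆ₐ[ℂ] (H →L[ℂ] H)) (U : G →ₗᵢ[ℂ] H) (a : R) : G →L[ℂ] G :=
  ContinuousLinearMap.adjoint U.toContinuousLinearMap ∘L ρ a ∘L U.toContinuousLinearMap

theorem compression_apply (ρ : R →⋆ₐ[ℂ] (H →L[ℂ] H)) (U : G →ₗᵢ[ℂ] H) (a : R) (g : G) :
    compression ρ U a g = ContinuousLinearMap.adjoint U.toContinuousLinearMap (ρ a (U g)) := rfl

/-- The range of `U` is invariant under `ρ`, so the compression is a genuine restriction;
multiplicativity rests on this. -/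
theorem map_compression {ρ : R →⋆ₐ[ℂ] (H →L[ℂ] H)} {U : G →ₗᵢ[ℂ] H} {k : H}
    (hU : Set.range U = cyclicSubspace ρ k) (a : R) (g : G) :
    U (compression ρ U a g) = ρ a (U g) := by
  have h1 : U g ∈ (cyclicSubspace ρ k : Set H) := hU ▸ Set.mem_range_self g
  obtain ⟨x, hx⟩ := h1
  have h2 : ρ a (U g) ∈ (cyclicSubspace ρ k : Set H) := ⟨a * x, by simp [← hx]⟩
  rw [← hU] at h2
  obtain ⟨g', hg'⟩ := h2
  rw [compression_apply, ← hg', U.adjoint_apply_apply]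

theorem norm_compression_le (ρ : R →⋆ₐ[ℂ] (H →L[ℂ] H)) (U : G →ₗᵢ[ℂ] H) (a : R) :
    ‖compression ρ U a‖ ≤ ‖a‖ := by
  refine ContinuousLinearMap.opNorm_le_bound _ (norm_nonneg _) fun g => ?_
  rw [compression_apply]
  have h1 : ‖ContinuousLinearMap.adjoint U.toContinuousLinearMap‖ ≤ 1 := by
    rw [LinearIsometryEquiv.norm_map]
    exact U.norm_toContinuousLinearMap_le
  calc _ ≤ 1 * ‖ρ a (U g)‖ := ContinuousLinearMap.le_of_opNorm_le _ h1 _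
    _ ≤ ‖a‖ * ‖g‖ := by
      rw [one_mul, ← U.norm_map g]
      exact ContinuousLinearMap.le_of_opNorm_le _ (NonUnitalStarAlgHom.norm_apply_le ρ a) _

theorem compression_add (ρ : R →⋆ₐ[ℂ] (H →L[ℂ] H)) (U : G →ₗᵢ[ℂ] H) (a b : R) :
    compression ρ U (a + b) = compression ρ U a + compression ρ U b := by
  ext; simp [compression_apply]

theorem compression_zero (ρ : R →⋆ₐ[ℂ] (H →L[ℂ] H)) (U : G →ₗᵢ[ℂ] H) :
    compression ρ U 0 = 0 := by
  ext; simp [compression_apply]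

theorem compression_smul (ρ : R →⋆ₐ[ℂ] (H →L[ℂ] H)) (U : G →ₗᵢ[ℂ] H) (c : ℂ) (a : R) :
    compression ρ U (c • a) = c • compression ρ U a := by
  ext; simp [compression_apply]

theorem compression_star (ρ : R →⋆ₐ[ℂ] (H →L[ℂ] H)) (U : G →ₗᵢ[ℂ] H) (a : R) :
    compression ρ U (star a) = star (compression ρ U a) := by
  simp only [compression, ContinuousLinearMap.star_eq_adjoint, ContinuousLinearMap.adjoint_comp,
    ContinuousLinearMap.adjoint_adjoint, map_star]
  rfl

theorem compression_mul {ρ : R →⋆ₐ[ℂ] (H →L[ℂ] H)} {U : G →ₗᵢ[ℂ] H} {k : H}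
    (hU : Set.range U = cyclicSubspace ρ k) (a b : R) :
    compression ρ U (a * b) = compression ρ U a * compression ρ U b := by
  ext g
  apply U.injective
  simp [map_compression hU]

end Compression

/-! ### The isomorphism onto the ℓ^∞-sum -/

section DirectSum

open Filter Topology InnerProductSpace

theorem Orthonormal.norm_sq_sum_smul_eq {ι E : Type*} [NormedAddCommGroup E]
    [InnerProductSpace ℂ E] {v : ι → E} (hv : Orthonormal ℂ v) (l : ι → ℂ) (s : Finset ι) :
    ‖∑ i ∈ s, l i • v i‖ ^ 2 = ∑ i ∈ s, ‖l i‖ ^ 2 := by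
  have h := hv.inner_sum l l s
  rw [inner_self_eq_norm_sq_to_K] at h
  simp only [Complex.conj_mul'] at h
  apply Complex.ofReal_injective
  push_cast
  exact h

variable {R : Type u} [CStarAlgebra R] {H : Type v} [NormedAddCommGroup H] [InnerProductSpace ℂ H]
  [CompleteSpace H] {I : Type*} {G : I → Type w} [∀ i, NormedAddCommGroup (G i)]
  [∀ i, InnerProductSpace ℂ (G i)] [∀ i, CompleteSpace (G i)]

/-- The direct sum of the restrictions of a representation to cyclic subspaces. -/
noncomputable def sumCompression (ρ : R →⋆ₐ[ℂ] (H →L[ℂ] H)) (U : ∀ i, G i →ₗᵢ[ℂ] H) (k : I → H)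
    (hU : ∀ i, Set.range (U i) = cyclicSubspace ρ (k i)) :
    R →⋆ₙₐ[ℂ] lp (fun i => G i →L[ℂ] G i) ∞ where
  toFun a := ⟨fun i => compression ρ (U i) a, memℓp_infty ⟨‖a‖, by
    rintro _ ⟨i, rfl⟩
    exact norm_compression_le ρ (U i) a⟩⟩
  map_smul' c a := Subtype.ext (funext fun i => compression_smul ρ (U i) c a)
  map_zero' := Subtype.ext (funext fun i => compression_zero ρ (U i))
  map_add' a b := Subtype.ext (funext fun i => compression_add ρ (U i) a b)
  map_mul' a b := Subtype.ext (funext fun i => compression_mul (hU i) a b)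
  map_star' a := Subtype.ext (funext fun i => compression_star ρ (U i) a)

theorem sumCompression_apply (ρ : R →⋆ₐ[ℂ] (H →L[ℂ] H)) (U : ∀ i, G i →ₗᵢ[ℂ] H) (k : I → H)
    (hU : ∀ i, Set.range (U i) = cyclicSubspace ρ (k i)) (a : R) (i : I) :
    sumCompression ρ U k hU a i = compression ρ (U i) a := rfl

/-- An element `a` of the kernel annihilates every `R * e i`, and so does its right support. If `a ≠
0`, an atom below that support contradicts `hmax`. -/
theorem sumCompression_injective (hat : IsAtomicAlgebra R) (ρ : R →⋆ₐ[ℂ] (H →L[ℂ] H))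
    (hρ : Function.Injective ρ) (S : VonNeumannAlgebra H) (hS : Set.range ρ = S)
    (U : ∀ i, G i →ₗᵢ[ℂ] H) (k : I → H) (hU : ∀ i, Set.range (U i) = cyclicSubspace ρ (k i))
    (e : I → R) (he : ∀ i, IsAtomicProjection (e i)) (hk : ∀ i, ‖k i‖ = 1)
    (hek : ∀ i, ρ (e i) (k i) = k i)
    (hmax : ∀ f, IsAtomicProjection f → ∃ i, ∃ b : R, f * b * e i ≠ 0) :
    Function.Injective (sumCompression ρ U k hU) := by
  rw [injective_iff_map_eq_zero]
  intro a ha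
  have h0 : ∀ i (x : R), a * (x * e i) = 0 := fun i x => by
    have hx : ρ x (k i) ∈ Set.range (U i) := by rw [hU i]; exact ⟨x, rfl⟩
    obtain ⟨g, hg⟩ := hx
    have h1 := map_compression (hU i) a g
    rw [← sumCompression_apply ρ U k hU, ha] at h1
    have h2 := (he i).norm_mul_eq ρ hρ S hS (hk i) (hek i) (a * x)
    rw [map_mul, mul_apply_eq_comp, ← hg, ← h1] at h2
    simpa [mul_assoc] using h2
  obtain ⟨p, hp, hap, hpb⟩ := exists_right_support ρ hρ S hS a
  by_contra hne
  obtain ⟨f, hf, -, hfp⟩ := hat p hp fun h => hne (by rw [← hap, h, mul_zero])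
  obtain ⟨i, b, hb⟩ := hmax f hf
  refine hb ?_
  have := hpb (f * b * e i) (h0 i _)
  rwa [← mul_assoc, ← mul_assoc, hfp] at this

/-- Rank-one operators in one coordinate lift to elements `x * e i * star y`. Finite sums of these
lift truncations of the target `T`, and a weak limit of the sums lifts `T` itself. -/
theorem sumCompression_surjective (ρ : R →⋆ₐ[ℂ] (H →L[ℂ] H))
    (S : VonNeumannAlgebra H) (hS : Set.range ρ = S) (hρ : Function.Injective ρ)
    (U : ∀ i, G i →ₗᵢ[ℂ] H) (k : I → H) (hU : ∀ i, Set.range (U i) = cyclicSubspace ρ (k i))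
    (e : I → R) (he : ∀ i, IsAtomicProjection (e i)) (hk : ∀ i, ‖k i‖ = 1)
    (hek : ∀ i, ρ (e i) (k i) = k i)
    (hdisj : ∀ i j, i ≠ j → ∀ b : R, e i * b * e j = 0)
    (hinj : Function.Injective (sumCompression ρ U k hU)) :
    Function.Surjective (sumCompression ρ U k hU) := by
  classical
  intro T
  choose s b hb using fun i => exists_hilbertBasis ℂ (G i)
  have hlift : ∀ i (g : G i), ∃ x : R, ρ x (k i) = U i g := fun i g => by
    have : U i g ∈ (cyclicSubspace ρ (k i) : Set H) := hU i ▸ Set.mem_range_self g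
    exact this
  choose X hX using hlift
  -- In coordinate `i` this acts as `T i` after the projection onto the basis vector `b i α`; by
  -- `hdisj` it acts as zero in the others.
  let t : (Σ i, s i) → R := fun q => X q.1 (T q.1 (b q.1 q.2)) * e q.1 * star (X q.1 (b q.1 q.2))
  have ht_same : ∀ i (α : s i) (g : G i),
      compression ρ (U i) (t ⟨i, α⟩) g = ⟪b i α, g⟫_ℂ • T i (b i α) := fun i α g => by
    apply (U i).injective
    rw [map_compression (hU i), ← hX i g, map_smul, ← hX i (T i _)]
    have h1 : t ⟨i, α⟩ * X i g * e i =
        X i (T i (b i α)) * (e i * (star (X i (b i α)) * X i g) * e i) := by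
      simp only [t, mul_assoc]
    rw [(he i).corner_eq ρ hρ S hS (hk i) (hek i), ← inner_conj_symm, inner_map_star_mul_self,
      inner_conj_symm, hX, hX, (U i).inner_map_map] at h1
    have h2 := congrArg (fun y => ρ y (k i)) h1
    simpa [hek] using h2
  have ht_ne : ∀ (q : Σ i, s i) j (g : G j), q.1 ≠ j →
      compression ρ (U j) (t q) g = 0 := fun q j g hne => by
    apply (U j).injective
    rw [map_compression (hU j), ← hX j g, map_zero]
    have h1 : t q * X j g * e j =
        X q.1 (T q.1 (b q.1 q.2)) * (e q.1 * (star (X q.1 (b q.1 q.2)) * X j g) * e j) := by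
      simp only [t, mul_assoc]
    rw [hdisj _ _ hne, mul_zero] at h1
    have h2 := congrArg (fun y => ρ y (k j)) h1
    simpa [hek] using h2
  let A : Finset (Σ i, s i) → R := fun F => ∑ q ∈ F, t q
  have hA : ∀ (F : Finset (Σ i, s i)) j (g : G j), compression ρ (U j) (A F) g =
      T j (∑ α ∈ F.preimage (Sigma.mk j) sigma_mk_injective.injOn, ⟪b j α, g⟫_ℂ • b j α) := by
    intro F j g
    have h1 : compression ρ (U j) (A F) g = ∑ q ∈ F, compression ρ (U j) (t q) g := by
      simp [A, compression_apply]
    rw [h1, map_sum]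
    simp_rw [map_smul, ← ht_same]
    rw [Finset.sum_preimage (Sigma.mk j) F sigma_mk_injective.injOn
      (fun q => compression ρ (U j) (t q) g)]
    intro q _ hq
    refine ht_ne q j g fun h => hq ?_
    obtain ⟨i, α⟩ := q
    subst h
    exact ⟨α, rfl⟩
  -- An injective ⋆-homomorphism is isometric, so the bound can be checked coordinatewise, where it
  -- is Bessel's inequality.
  have hnorm : ∀ F, ‖ρ (A F)‖ ≤ ‖T‖ := fun F => by
    refine (NonUnitalStarAlgHom.norm_apply_le ρ _).trans ?_
    rw [← NonUnitalStarAlgHom.norm_map (sumCompression ρ U k hU) hinj]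
    refine lp.norm_le_of_forall_le (norm_nonneg _) fun j => ?_
    refine ContinuousLinearMap.opNorm_le_bound _ (norm_nonneg _) fun g => ?_
    rw [sumCompression_apply, hA]
    refine ((T j).le_of_opNorm_le (lp.norm_apply_le_norm ENNReal.top_ne_zero T j) _).trans ?_
    gcongr
    refine (sq_le_sq₀ (norm_nonneg _) (norm_nonneg _)).1 ?_
    rw [(b j).orthonormal.norm_sq_sum_smul_eq]
    exact (b j).orthonormal.sum_inner_products_le g
  let u : Ultrafilter (Finset (Σ i, s i)) := Ultrafilter.of atTop
  have hu : (u : Filter (Finset (Σ i, s i))) ≤ atTop := Ultrafilter.of_le atTop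
  obtain ⟨B, hB⟩ := exists_weak_limit_of_bounded u (fun F => ρ (A F)) ‖T‖ hnorm
  have hBS : B ∈ S := S.mem_of_weak_limit (fun F => by
    rw [← SetLike.mem_coe, ← hS]; exact ⟨_, rfl⟩) hB
  rw [← SetLike.mem_coe, ← hS] at hBS
  obtain ⟨a, rfl⟩ := hBS
  refine ⟨a, Subtype.ext (funext fun j => ?_)⟩
  change compression ρ (U j) a = T j
  refine ContinuousLinearMap.ext_on
    (Submodule.dense_iff_topologicalClosure_eq_top.2 (b j).dense_span) ?_
  rintro _ ⟨β, rfl⟩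
  apply (U j).injective
  rw [map_compression (hU j)]
  refine ext_inner_right ℂ fun y => tendsto_nhds_unique (hB _ y) ?_
  -- On a basis vector `b j β` the net is constant as soon as `F` contains `⟨j, β⟩`.
  refine tendsto_const_nhds.congr' (hu ?_)
  filter_upwards [eventually_ge_atTop {⟨j, β⟩}] with F hF
  rw [← map_compression (hU j), hA]
  congr 3
  rw [Finset.sum_eq_single β]
  · rw [inner_self_eq_norm_sq_to_K, (b j).orthonormal.1]
    simp
  · intro α _ hα
    rw [(b j).orthonormal.2 hα, zero_smul]
  · intro h
    exact absurd (Finset.mem_preimage.2 (hF (Finset.mem_singleton_self _))) h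

end DirectSum

/-! ### Choice of atoms and the forward implication -/

section Classification

open Filter Topology InnerProductSpace

variable {R : Type u} [CStarAlgebra R]

theorem exists_enat_equiv (α : Type*) [Countable α] :
    ∃ n : ℕ∞, Nonempty ({i : ℕ // (i : ℕ∞) < n} ≃ α) := by
  rcases finite_or_infinite α with h | h
  · refine ⟨(Nat.card α : ℕ∞), ⟨Equiv.trans ?_ (Finite.equivFin α).symm⟩⟩
    exact (Equiv.subtypeEquivRight fun i => by simp).trans Fin.equivSubtype.symm
  · obtain ⟨e⟩ := nonempty_equiv_of_countable (α := ℕ) (β := α)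
    exact ⟨⊤, ⟨(Equiv.subtypeUnivEquiv fun i => ENat.natCast_lt_top i).trans e⟩⟩

/-- There is a maximal family of atomic projections with pairwise orthogonal central supports. -/
theorem exists_maximal_disjoint_atoms (R : Type u) [CStarAlgebra R] :
    ∃ M : Set R, (∀ e ∈ M, IsAtomicProjection e) ∧
      (M.Pairwise fun e f => ∀ b : R, e * b * f = 0) ∧
      ∀ f, IsAtomicProjection f → ∃ e ∈ M, ∃ b : R, f * b * e ≠ 0 := by
  obtain ⟨M, hM⟩ := zorn_subset {M : Set R | (∀ e ∈ M, IsAtomicProjection e) ∧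
      M.Pairwise fun e f => ∀ b : R, e * b * f = 0} fun c hc hchain =>
    ⟨⋃₀ c, ⟨fun e ⟨s, hs, he⟩ => (hc hs).1 e he,
      hchain.pairwise_sUnion.2 fun s hs => (hc hs).2⟩, fun s hs => Set.subset_sUnion_of_mem hs⟩
  refine ⟨M, hM.prop.1, hM.prop.2, fun f hf => ?_⟩
  by_contra! h
  have hfM : f ∈ M := by
    refine hM.le_of_ge (y := insert f M) ⟨?_, ?_⟩ (Set.subset_insert f M) (Set.mem_insert f M)
    · rintro e (rfl | he)
      exacts [hf, hM.prop.1 e he]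
    · refine hM.prop.2.insert fun e he _ => ⟨h e he, fun b => ?_⟩
      have := congrArg star (h e he (star b))
      simpa [mul_assoc, hf.1.isSelfAdjoint.star_eq, (hM.prop.1 e he).1.isSelfAdjoint.star_eq]
        using this
  -- Maximality has put `f` into `M`, so `f * 1 * f = 0`.
  refine hf.2.1 ?_
  have := h f hfM 1
  rwa [mul_one, hf.1.isIdempotentElem.eq] at this

theorem separableSpace_l2 (ι : Type*) [Countable ι] :
    TopologicalSpace.SeparableSpace (lp (fun _ : ι => ℂ) 2) := by
  let b : HilbertBasis ι ℂ (lp (fun _ : ι => ℂ) 2) := ⟨LinearIsometryEquiv.refl ℂ _⟩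
  have h := ((Set.countable_range b).isSeparable.span (R := ℂ)).closure
  rw [← Submodule.topologicalClosure_coe, b.dense_span, Submodule.top_coe] at h
  exact TopologicalSpace.isSeparable_univ_iff.1 h

theorem isCountableSum_of_sigmaFinite_of_atomic (hR : IsWStarAlgebra.{u, v} R)
    (hσ : IsSigmaFiniteAlgebra R) (hat : IsAtomicAlgebra R) :
    IsCountableSumOfBoundedOperators.{u, w} R := by
  obtain ⟨H, _, _, _, S, ⟨φ⟩⟩ := hR
  let ρ : R →⋆ₐ[ℂ] (H →L[ℂ] H) := S.toStarSubalgebra.subtype.comp (φ : R →⋆ₐ[ℂ] _)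
  have hρ : Function.Injective ρ := Subtype.val_injective.comp φ.injective
  have hS : Set.range ρ = S := by
    change Set.range (Subtype.val ∘ φ) = _
    rw [Set.range_comp, show Set.range φ = Set.univ from φ.surjective.range_eq, Set.image_univ]
    exact Subtype.range_coe
  obtain ⟨M, hMa, hMd, hMm⟩ := exists_maximal_disjoint_atoms R
  have hMc : M.Countable := hσ M (fun e he => (hMa e he).1) fun e he f hf hne => by
    simpa using hMd he hf hne 1
  have : Countable M := hMc
  obtain ⟨n, ⟨ε⟩⟩ := exists_enat_equiv M
  choose ι hι U k hk hek hU using fun i =>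
    (hMa (ε i) (ε i).2).exists_cyclic_model.{u, v, w} hσ ρ hρ S hS
  have hinj := sumCompression_injective hat ρ hρ S hS U k hU (fun i => ε i)
    (fun i => hMa _ (ε i).2) hk hek fun f hf => by
      obtain ⟨e, he, b, hb⟩ := hMm f hf
      exact ⟨ε.symm ⟨e, he⟩, b, by simpa using hb⟩
  have hsurj := sumCompression_surjective ρ S hS hρ U k hU (fun i => ε i)
    (fun i => hMa _ (ε i).2) hk hek (fun i j hij =>
      hMd (ε i).2 (ε j).2 fun h => hij (ε.injective (Subtype.ext h))) hinj
  exact ⟨n, fun i => lp (fun _ : ι i => ℂ) 2, inferInstance, inferInstance, inferInstance,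
    fun i => separableSpace_l2 (ι i),
    ⟨StarAlgEquiv.ofBijective (sumCompression ρ U k hU) ⟨hinj, hsurj⟩⟩⟩

/-! ### The converse: ℓ^∞-sums are atomic and σ-finite -/

/-- Pairwise orthogonal nonzero projections on a separable Hilbert space form a countable family. -/
theorem countable_of_orthogonal_projections {H : Type*} [NormedAddCommGroup H]
    [InnerProductSpace ℂ H] [CompleteSpace H] [TopologicalSpace.SeparableSpace H] {α : Type*}
    {s : Set α} (p : α → H →L[ℂ] H) (hp : ∀ a ∈ s, IsStarProjection (p a))
    (hp0 : ∀ a ∈ s, p a ≠ 0) (horth : s.Pairwise fun a b => p a * p b = 0) : s.Countable := by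
  have hv : ∀ a, ∃ x : H, a ∈ s → ‖x‖ = 1 ∧ p a x = x := fun a => by
    by_cases ha : a ∈ s
    · obtain ⟨x, hx⟩ : ∃ x, p a x ≠ 0 := by
        by_contra! h
        exact hp0 a ha (ContinuousLinearMap.ext h)
      refine ⟨((‖p a x‖⁻¹ : ℝ) : ℂ) • p a x, fun _ => ⟨?_, ?_⟩⟩
      · rw [norm_smul]
        simp [inv_mul_cancel₀ (norm_ne_zero_iff.2 hx)]
      · rw [map_smul, ← mul_apply_eq_comp, (hp a ha).isIdempotentElem.eq]
    · exact ⟨0, fun h => absurd h ha⟩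
  choose x hx using hv
  -- Orthogonal unit vectors are at distance `√2 ≥ 1`, so balls of radius `1 / 2` are disjoint.
  refine Set.PairwiseDisjoint.countable_of_isOpen (s := fun a => Metric.ball (x a) (1 / 2))
    (fun a ha b hb hne => ?_) (fun a _ => Metric.isOpen_ball)
    (fun a _ => ⟨x a, Metric.mem_ball_self (by norm_num)⟩)
  refine Metric.ball_disjoint_ball ?_
  have hin : ⟪x a, x b⟫_ℂ = 0 := by
    rw [← (hx a ha).2, ← (hx b hb).2, ← ContinuousLinearMap.adjoint_inner_right,
      ← ContinuousLinearMap.star_eq_adjoint, (hp a ha).isSelfAdjoint.star_eq, ← mul_apply_eq_comp,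
      horth ha hb hne, zero_apply, inner_zero_right]
  have hd : ‖x a - x b‖ * ‖x a - x b‖ = 2 := by
    rw [@norm_sub_mul_self ℂ, hin, (hx a ha).1, (hx b hb).1]
    norm_num
  rw [dist_eq_norm]
  nlinarith [norm_nonneg (x a - x b)]

/-- Rank-one projections are minimal among the nonzero projections. -/
theorem exists_rankOne_projection {H : Type*} [NormedAddCommGroup H] [InnerProductSpace ℂ H]
    [CompleteSpace H] {x : H} (hx : ‖x‖ = 1) :
    ∃ p : H →L[ℂ] H, IsStarProjection p ∧ (∀ y, p y = ⟪x, y⟫_ℂ • x) ∧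
      ∀ q : H →L[ℂ] H, q * q = q → q * p = q → p * q = q → q ≠ 0 → q = p := by
  have hp : ∀ y, rankOne ℂ x x y = ⟪x, y⟫_ℂ • x := fun y => rankOne_apply ..
  have hxx : ⟪x, x⟫_ℂ = 1 := by rw [inner_self_eq_norm_sq_to_K, hx]; simp
  refine ⟨rankOne ℂ x x, isStarProjection_iff'.2 ⟨?_, ?_⟩, hp, fun q hq hqp hpq hq0 => ?_⟩
  · ext y
    simp [hx]
  · rw [ContinuousLinearMap.star_eq_adjoint]
    refine ((ContinuousLinearMap.eq_adjoint_iff _ _).2 fun y z => ?_).symm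
    rw [hp, hp, inner_smul_left, inner_smul_right, inner_conj_symm, mul_comm]
  -- Here `q = p * q * p` is a scalar multiple of `p`; idempotence and `q ≠ 0` force the scalar to
  -- be `1`.
  · have hqx : ∀ y, q y = (⟪x, y⟫_ℂ * ⟪x, q x⟫_ℂ) • x := fun y => by
      conv_lhs => rw [← hqp, ← hpq]
      rw [mul_apply_eq_comp, mul_apply_eq_comp, hp y, map_smul, map_smul, hp, smul_smul]
    have hc := congrArg (fun r => ⟪x, r x⟫_ℂ) hq
    rw [mul_apply_eq_comp, hqx (q x), inner_smul_right, hxx, mul_one] at hc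
    have hc1 : ⟪x, q x⟫_ℂ = 1 := by
      refine mul_left_cancel₀ (a := ⟪x, q x⟫_ℂ) (fun h0 => hq0 ?_) (by rw [hc, mul_one])
      ext y
      rw [hqx, h0, mul_zero, zero_smul, zero_apply]
    ext y
    rw [hqx, hc1, mul_one, hp]

section Converse

variable {I : Type*} {G : I → Type w} [∀ i, NormedAddCommGroup (G i)]
  [∀ i, InnerProductSpace ℂ (G i)] [∀ i, CompleteSpace (G i)]

theorem IsStarProjection.map_lp_apply {p : R} (hp : IsStarProjection p)
    (Φ : R ≃⋆ₐ[ℂ] lp (fun i => G i →L[ℂ] G i) ∞) (i : I) : IsStarProjection (Φ p i) := by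
  have h := isStarProjection_iff'.1 hp
  refine isStarProjection_iff'.2 ⟨?_, ?_⟩
  · have h1 := congrArg Φ h.1
    rw [map_mul] at h1
    exact congrArg (fun q : lp (fun i => G i →L[ℂ] G i) ∞ => q i) h1
  · have h2 := congrArg Φ h.2
    rw [map_star] at h2
    exact congrArg (fun q : lp (fun i => G i →L[ℂ] G i) ∞ => q i) h2

theorem isSigmaFinite_of_starAlgEquiv_lp [Countable I]
    [∀ i, TopologicalSpace.SeparableSpace (G i)]
    (Φ : R ≃⋆ₐ[ℂ] lp (fun i => G i →L[ℂ] G i) ∞) : IsSigmaFiniteAlgebra R := by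
  intro P hP horth
  -- A nonzero projection is nonzero in some coordinate, and each of the countably many coordinates
  -- sees only countably many.
  have hcov : P ⊆ {0} ∪ ⋃ i, {e ∈ P | Φ e i ≠ 0} := fun e he => by
    by_cases h : ∀ i, Φ e i = 0
    · left
      exact (map_eq_zero_iff Φ Φ.injective).1 (Subtype.ext (funext h))
    · push Not at h
      obtain ⟨i, hi⟩ := h
      exact Or.inr (Set.mem_iUnion.2 ⟨i, he, hi⟩)
  refine Set.Countable.mono hcov ((Set.countable_singleton 0).union (Set.countable_iUnion fun i => ?_))
  refine countable_of_orthogonal_projections (fun e => Φ e i)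
    (fun e he => (hP e he.1).map_lp_apply Φ i) (fun e he => he.2) fun e he f hf hne => ?_
  have h := congrArg Φ (horth he.1 hf.1 hne)
  rw [map_mul, map_zero] at h
  exact congrArg (fun q : lp (fun i => G i →L[ℂ] G i) ∞ => q i) h

theorem isAtomic_of_starAlgEquiv_lp (Φ : R ≃⋆ₐ[ℂ] lp (fun i => G i →L[ℂ] G i) ∞) :
    IsAtomicAlgebra R := by
  classical
  intro e he he0
  have hΦ : Function.Injective Φ := Φ.injective
  obtain ⟨i, hi⟩ : ∃ i, Φ e i ≠ 0 := by
    by_contra! h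
    exact he0 ((map_eq_zero_iff Φ hΦ).1 (Subtype.ext (funext h)))
  have hE := he.map_lp_apply Φ i
  obtain ⟨x₀, hx₀⟩ : ∃ x, Φ e i x ≠ 0 := by
    by_contra! h
    exact hi (ContinuousLinearMap.ext h)
  set x : G i := ((‖Φ e i x₀‖⁻¹ : ℝ) : ℂ) • Φ e i x₀ with hxdef
  have hx1 : ‖x‖ = 1 := by
    rw [hxdef, norm_smul]
    simp [inv_mul_cancel₀ (norm_ne_zero_iff.2 hx₀)]
  have hxE : Φ e i x = x := by
    rw [hxdef, map_smul, ← mul_apply_eq_comp, hE.isIdempotentElem.eq]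
  have hxx : ⟪x, x⟫_ℂ = 1 := by rw [inner_self_eq_norm_sq_to_K, hx1]; simp
  obtain ⟨p, hP, hp, hpmin⟩ := exists_rankOne_projection hx1
  have hpp : p * p = p := hP.isIdempotentElem
  have hps : star p = p := hP.isSelfAdjoint
  -- Since `x` lies in the range of `Φ e i`, `F` is below `Φ e`. A projection below `F` vanishes off
  -- `i`, so minimality reduces to that of `p`.
  let F : lp (fun i => G i →L[ℂ] G i) ∞ := lp.single ∞ i p
  have hFi : F i = p := lp.single_apply_self ..
  have hFj : ∀ j, j ≠ i → F j = 0 := fun j hj => lp.single_apply_ne _ _ _ hj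
  have hext : ∀ A B : lp (fun i => G i →L[ℂ] G i) ∞, A i = B i → (∀ j, j ≠ i → A j = B j) →
      A = B := fun A B h1 h2 => Subtype.ext (funext fun j => by
    by_cases hj : j = i
    · subst hj; exact h1
    · exact h2 j hj)
  have hmul : ∀ (A B : lp (fun i => G i →L[ℂ] G i) ∞) j, (A * B) j = A j * B j :=
    fun _ _ _ => rfl
  have hF : IsStarProjection F := by
    rw [isStarProjection_iff']
    constructor
    · refine hext _ _ (by rw [hmul, hFi, hpp]) fun j hj => by rw [hmul, hFj j hj, mul_zero]
    · refine hext _ _ (by rw [lp.star_apply, hFi, hps]) fun j hj => by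
        rw [lp.star_apply, hFj j hj, star_zero]
  have hp0 : p ≠ 0 := fun h => by
    have := hp x
    rw [h, hxx, one_smul, zero_apply] at this
    rw [← this, norm_zero] at hx1
    exact zero_ne_one hx1
  have hΦF : Φ (Φ.symm F) = F := Φ.apply_symm_apply F
  refine ⟨Φ.symm F, ⟨hF.map Φ.symm, fun h => ?_, fun g hg hg0 hgF => ?_⟩, ?_, ?_⟩
  · refine hp0 ?_
    rw [← hFi, ← hΦF, h, map_zero]
    rfl
  · apply hΦ
    have h1 := congrArg Φ hgF.1
    have h2 := congrArg Φ hgF.2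
    rw [map_mul, hΦF] at h1 h2
    have hQj : ∀ j, j ≠ i → Φ g j = 0 := fun j hj => by
      rw [← h1, hmul, hFj j hj, mul_zero]
    have h1i : Φ g i * p = Φ g i := by rw [← hFi, ← hmul, h1]
    have h2i : p * Φ g i = Φ g i := by rw [← hFi, ← hmul, h2]
    have hQ : Φ g i * Φ g i = Φ g i := (hg.map_lp_apply Φ i).isIdempotentElem
    have hg0i : Φ g i ≠ 0 := fun h =>
      hg0 ((map_eq_zero_iff Φ hΦ).1 (hext _ _ (by rw [h]; rfl) hQj))
    have hgp := hpmin _ hQ h1i h2i hg0i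
    rw [hΦF]
    exact hext _ _ (by rw [hFi, hgp]) fun j hj => by rw [hQj j hj, hFj j hj]
  · apply hΦ
    rw [map_mul, hΦF]
    refine hext _ _ ?_ fun j hj => by rw [hmul, hFj j hj, zero_mul]
    rw [hmul, hFi]
    ext y
    have : ⟪x, Φ e i y⟫_ℂ = ⟪x, y⟫_ℂ := by
      rw [← ContinuousLinearMap.adjoint_inner_left, ← ContinuousLinearMap.star_eq_adjoint,
        hE.isSelfAdjoint.star_eq, hxE]
    simp [hp, this]
  · apply hΦ
    rw [map_mul, hΦF]
    refine hext _ _ ?_ fun j hj => by rw [hmul, hFj j hj, mul_zero]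
    rw [hmul, hFi]
    ext y
    simp [hp, hxE]

end Converse

end Classification

theorem mainTheorem1 (R : Type u) [CStarAlgebra R] (hR : IsWStarAlgebra.{u, v} R) :
    (IsSigmaFiniteAlgebra R ∧ IsAtomicAlgebra R) ↔
      IsCountableSumOfBoundedOperators.{u, w} R := by
  refine ⟨fun h => isCountableSum_of_sigmaFinite_of_atomic hR h.1 h.2, ?_⟩
  rintro ⟨n, H, _, _, _, _, ⟨Φ⟩⟩
  exact ⟨isSigmaFinite_of_starAlgEquiv_lp Φ, isAtomic_of_starAlgEquiv_lp Φ⟩
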